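/- Let $m\ge 0$ and $\lambda,\alpha\in\mathbb{N}_0^m$. Let $V(\lambda)$ be the complex vector space of polynomials in $x_1,y_1,\dots,x_m,y_m$ that are homogeneous of degree $\lambda_k$ in the pair $(x_k,y_k)$ for every $k$; such a polynomial has a well-defined zero set in $(\mathbb{CP}^1)^m$. For $\Omega\subseteq(\mathbb{CP}^1)^m$, call $p\in V(\lambda)$ \emph{$\Omega$-stable} if it has no zero in $\Omega$, and \emph{weakly $\Omega$-stable} if it is $\Omega$-stable or $p\equiv 0$. A linear map $T:V(\lambda)\to V(\alpha)$ \emph{preserves weak $\Omega$-stability} if $T(p)$ is weakly $\Omega$-stable for every $\Omega$-stable $p\in V(\lambda)$. The \emph{symbol} of $T$ is the polynomial \[ \operatorname{Symb}(T)=\sum_{\mu\le\lambda}\binom{\lambda}{\mu}\,z^{\lambda-\mu}(-w)^{\mu}\;T(x^{\mu}y^{\lambda-\mu})\in V(\lambda\sqcup\alpha), \] where $(z_k,w_k)$ are the first $m$ pairs of variables and $(x_k,y_k)$ the last $m$ pairs. An \emph{open circular region} in $\mathbb{CP}^1=\mathbb{C}\cup\{\infty\}$ is an open disc, the complement in $\mathbb{CP}^1$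 of a closed disc (of positive radius), or an open half-plane. Closures $\overline{C}$ and complements $C^c$ are taken in $\mathbb{CP}^1$. Let $T:V(\lambda)\to V(\alpha)$ be a linear map. (1) For all open circular regions $C_1,\dots,C_m\subseteq\mathbb{CP}^1$, the map $T$ preserves weak $(C_1\times\cdots\times C_m)$-stability if and only if at least one of the following holds: (a) $\operatorname{Symb}(T)$ is $(\overline{C_1}^c\times\cdots\times\overline{C_m}^c)\times(C_1\times\cdots\times C_m)$-stable; (b) $T=p_0\cdot\psi$, that is, $T(p)=\psi(p)\,p_0$ for all $p \in V(\lambda)$, for some weakly $(C_1\times\cdots\times C_m)$-stable $p_0\in V(\alpha)$ and some linear functional $\psi:V(\lambda)\to\mathbb{C}$. (2) In particular, with $\mathcal{H}_+,\mathcal{H}_-\subset\mathbb{C}\subset\mathbb{CP}^1$ the open upper and lower half-planes, $T$ preserves weak $\mathcal{H}_+^m$-stability if and only if $\operatorname{Symb}(T)$ is $(\mathcal{H}_-^m\times\mathcal{H}_+^m)$-stable, or $T=p_0\cdot\psi$ for some weakly $\mathcal{H}_+^m$-stable $p_0\in V(\alpha)$ and some linear functional $\psi:V(\lambda)\to\mathbb{C}$.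 -/

import Mathlib

noncomputable section

namespace UniversalSymbol

/-- The complex projective line: one-dimensional subspaces of `ℂ²`. -/
abbrev CP1 : Type := Projectivization ℂ (Fin 2 → ℂ)

/-- `CP1` carries the quotient topology of `ℂ² \ {0}`. -/
instance instTopologicalSpaceCP1 : TopologicalSpace CP1 :=
  TopologicalSpace.coinduced
    (fun v : {v : Fin 2 → ℂ // v ≠ 0} => Projectivization.mk ℂ v.1 v.2) inferInstance

/-- The inclusion `z ↦ (z : 1)` of the affine line in `CP1`; its image misses only `∞ = (1 : 0)`. -/
def ofComplex (z : ℂ) : CP1 :=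
  Projectivization.mk ℂ ![z, 1] (fun h => one_ne_zero (congrFun h 1))

/-- Open circular regions of `CP1`: open discs, exteriors of closed discs (which contain `∞`),
and open half-planes (which do not). -/
def IsOpenCircularRegion (S : Set CP1) : Prop :=
  (∃ (c : ℂ) (r : ℝ), 0 < r ∧ S = ofComplex '' Metric.ball c r) ∨
  (∃ (c : ℂ) (r : ℝ), 0 < r ∧ S = (ofComplex '' Metric.closedBall c r)ᶜ) ∨
  (∃ a b : ℂ, a ≠ 0 ∧ S = ofComplex '' {z | 0 < (a * z + b).re})

/-- The open upper half-plane in `CP1`. -/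
def upperHP : Set CP1 := ofComplex '' {z | 0 < z.im}

/-- The open lower half-plane in `CP1`. -/
def lowerHP : Set CP1 := ofComplex '' {z | z.im < 0}

/-- The space `V(lam)` of complex polynomials in the variables `x k = X (k, 0)`, `y k = X (k, 1)`
that are, for every `k`, homogeneous of degree `lam k` in the pair `x k`, `y k`. -/
abbrev V {ι : Type*} [DecidableEq ι] (lam : ι → ℕ) :
    Submodule ℂ (MvPolynomial (ι × Fin 2) ℂ) :=
  MvPolynomial.weightedHomogeneousSubmodule ℂ
    (fun a : ι × Fin 2 => (Pi.single a.1 1 : ι → ℕ)) lam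

/-- `p` is `Ω`-stable: it does not vanish at any point of `Ω`, a set of points of `(CP1)^ι`.
By homogeneity, (non)vanishing does not depend on the homogeneous coordinates `v k` chosen for
the `k`-th component of the point. -/
def IsStable {ι : Type*} [DecidableEq ι] {lam : ι → ℕ} (Ω : Set (ι → CP1)) (p : V lam) : Prop :=
  ∀ (v : ι → Fin 2 → ℂ) (hv : ∀ k, v k ≠ 0),
    (fun k => Projectivization.mk ℂ (v k) (hv k)) ∈ Ω →
      MvPolynomial.eval (fun a : ι × Fin 2 => v a.1 a.2) (p : MvPolynomial (ι × Fin 2) ℂ) ≠ 0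

/-- `p` is weakly `Ω`-stable: it is `Ω`-stable or identically zero. -/
def IsWeaklyStable {ι : Type*} [DecidableEq ι] {lam : ι → ℕ} (Ω : Set (ι → CP1)) (p : V lam) :
    Prop :=
  IsStable Ω p ∨ p = 0

/-- `T` preserves weak `Ω`-stability: it maps `Ω`-stable polynomials to weakly `Ω`-stable ones. -/
def PreservesWeakStability {ι : Type*} [DecidableEq ι] {lam alpha : ι → ℕ} (Ω : Set (ι → CP1))
    (T : V lam →ₗ[ℂ] V alpha) : Prop :=
  ∀ p : V lam, IsStable Ω p → IsWeaklyStable Ω (T p)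

/-- The monomial `x^mu * y^(lam - mu)` of `V lam`, for `mu ≤ lam`. -/
def basisMonomial {ι : Type*} [Fintype ι] [DecidableEq ι] {lam : ι → ℕ}
    (mu : ∀ k, Fin (lam k + 1)) : V lam :=
  ⟨∏ k, MvPolynomial.X (k, 0) ^ (mu k : ℕ) * MvPolynomial.X (k, 1) ^ (lam k - mu k : ℕ), by
    rw [MvPolynomial.mem_weightedHomogeneousSubmodule]
    have h := MvPolynomial.IsWeightedHomogeneous.prod (R := ℂ)
      (w := fun a : ι × Fin 2 => (Pi.single a.1 1 : ι → ℕ)) Finset.univ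
      (fun k : ι => (MvPolynomial.X (k, 0) ^ (mu k : ℕ) *
        MvPolynomial.X (k, 1) ^ (lam k - mu k : ℕ) : MvPolynomial (ι × Fin 2) ℂ))
      (fun k => (mu k : ℕ) • (Pi.single k 1 : ι → ℕ) + (lam k - mu k : ℕ) • Pi.single k 1)
      (fun k _ => ((MvPolynomial.isWeightedHomogeneous_X ℂ _ (k, 0)).pow _).mul
        ((MvPolynomial.isWeightedHomogeneous_X ℂ _ (k, 1)).pow _))
    convert h using 1
    ext j
    have hk : ∀ k : ι, (mu k : ℕ) + (lam k - mu k) = lam k := fun k => by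
      have := (mu k).isLt
      omega
    simp [Finset.sum_apply, Pi.single_apply, Finset.sum_add_distrib, hk]⟩

/-- A polynomial in the variables `x`, `y` of the second block, viewed as a polynomial in both
blocks of variables. -/
def inSecondBlock {ι κ : Type*} (p : MvPolynomial (κ × Fin 2) ℂ) :
    MvPolynomial ((ι ⊕ κ) × Fin 2) ℂ :=
  MvPolynomial.rename (fun a : κ × Fin 2 => ((Sum.inr a.1 : ι ⊕ κ), a.2)) p

theorem inSecondBlock_isWeightedHomogeneous {ι κ : Type*} [DecidableEq ι] [DecidableEq κ]
    {alpha : κ → ℕ} (p : V alpha) :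
    MvPolynomial.IsWeightedHomogeneous
      (fun a : (ι ⊕ κ) × Fin 2 => (Pi.single a.1 1 : ι ⊕ κ → ℕ))
      (inSecondBlock (ι := ι) (p : MvPolynomial (κ × Fin 2) ℂ)) (Sum.elim 0 alpha) := by
  intro d hd
  obtain ⟨u, rfl, hu⟩ := MvPolynomial.coeff_rename_ne_zero _ _ _ hd
  have h := p.2 hu
  rw [Finsupp.weight_apply] at h ⊢
  rw [Finsupp.sum_mapDomain_index (by simp) (by intros; simp [add_smul])]
  have hj : ∀ j, (u.sum fun i c => c • (Pi.single i.1 1 : κ → ℕ)) j = alpha j := fun j => by rw [h]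
  ext j
  rcases j with j | j
  · simp [Finsupp.sum, Finset.sum_apply]
  · simpa [Finsupp.sum, Finset.sum_apply, Pi.single_apply] using hj j

theorem firstBlock_isWeightedHomogeneous {ι κ : Type*} [Fintype ι] [DecidableEq ι] [DecidableEq κ]
    {lam : ι → ℕ} (mu : ∀ k, Fin (lam k + 1)) :
    MvPolynomial.IsWeightedHomogeneous
      (fun a : (ι ⊕ κ) × Fin 2 => (Pi.single a.1 1 : ι ⊕ κ → ℕ))
      (∏ k, MvPolynomial.X (Sum.inl k, 0) ^ (lam k - mu k : ℕ) *
        (-MvPolynomial.X (Sum.inl k, 1)) ^ (mu k : ℕ) : MvPolynomial ((ι ⊕ κ) × Fin 2) ℂ)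
      (Sum.elim lam 0) := by
  have h := MvPolynomial.IsWeightedHomogeneous.prod (R := ℂ)
    (w := fun a : (ι ⊕ κ) × Fin 2 => (Pi.single a.1 1 : ι ⊕ κ → ℕ)) Finset.univ
    (fun k : ι => (MvPolynomial.X (Sum.inl k, 0) ^ (lam k - mu k : ℕ) *
      (-MvPolynomial.X (Sum.inl k, 1)) ^ (mu k : ℕ) : MvPolynomial ((ι ⊕ κ) × Fin 2) ℂ))
    (fun k => (lam k - mu k : ℕ) • (Pi.single (Sum.inl k) 1 : ι ⊕ κ → ℕ) +
      (mu k : ℕ) • Pi.single (Sum.inl k) 1)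
    (fun k _ => ((MvPolynomial.isWeightedHomogeneous_X ℂ _ (Sum.inl k, 0)).pow _).mul
      ((MvPolynomial.isWeightedHomogeneous_X ℂ _ (Sum.inl k, 1)).neg.pow _))
  convert h using 1
  have hk : ∀ k : ι, (lam k - mu k) + (mu k : ℕ) = lam k := fun k => by
    have := (mu k).isLt
    omega
  ext j
  rcases j with j | j
  · simp [Finset.sum_apply, Pi.single_apply, Finset.sum_add_distrib, hk]
  · simp [Finset.sum_apply]

/-- The universal symbol
`Symb(T) = T[(z y - x w)^lam] = ∑_{mu ≤ lam} (lam choose mu) z^(lam - mu) (-w)^mu T(x^mu y^(lam - mu))`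
in `V(lam ⊔ alpha)`. The first block of variables is `z k = X (inl k, 0)`, `w k = X (inl k, 1)`,
the second is `x k = X (inr k, 0)`, `y k = X (inr k, 1)`. -/
def symb {ι κ : Type*} [Fintype ι] [DecidableEq ι] [DecidableEq κ] {lam : ι → ℕ}
    {alpha : κ → ℕ} (T : V lam →ₗ[ℂ] V alpha) : V (Sum.elim lam alpha) :=
  ⟨∑ mu : (∀ k, Fin (lam k + 1)),
    MvPolynomial.C ((∏ k, (lam k).choose (mu k) : ℕ) : ℂ) *
      (∏ k, MvPolynomial.X (Sum.inl k, 0) ^ (lam k - mu k : ℕ) *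
        (-MvPolynomial.X (Sum.inl k, 1)) ^ (mu k : ℕ)) *
      inSecondBlock (T (basisMonomial mu) : MvPolynomial (κ × Fin 2) ℂ), by
    rw [MvPolynomial.mem_weightedHomogeneousSubmodule]
    refine MvPolynomial.IsWeightedHomogeneous.sum _ _ _ fun mu _ => ?_
    convert ((firstBlock_isWeightedHomogeneous (κ := κ) mu).C_mul _).mul
      (inSecondBlock_isWeightedHomogeneous (ι := ι) (T (basisMonomial mu))) using 1
    ext j
    rcases j with j | j <;> simp⟩

end UniversalSymbol

end

/-! Write each circular region as a cone `‖(E v) 1‖ < ‖(E v) 0‖` with `E` invertible; exchanging the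
rows of `E` gives the complement of the closure. The symbol at `(z, u)` is the value at `u` of `T`
applied to the product of the powers `[z k, x k] ^ lam k` of linear forms, where `[·,·]` is the
determinant. Such products span `V lam`.

Necessity. For `z` in the opposite cones, the product `powProd lam z` has no zero on the closed
regions. If `T` kills none of these products, they are stable with nonzero images, and stability of
the images is stability of the symbol. If `T` kills one, compactness makes `powProd lam z + ε q`
stable for any `q` and some `ε ≠ 0`, so every `T q` is weakly stable. Cancelling a value at one
point by a linear combination then forces rank at most one.

Sufficiency. For fixed `u`, the number `T p (u)` is the apolar pairing of `p` with the polynomial `z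
↦ T (powProd lam z) (u)`. Grace's theorem (`contract_ne_zero`) makes such a pairing nonzero when the
two nonvanishing regions overlap and cover the projective line in each coordinate. It rests on
Laguerre's theorem (`polar_ne_zero`, from Gauss–Lucas) and a remark on symmetric bilinear forms. A
region and its opposite miss the boundary circle, so `p` is first composed with a contraction of
parameter `s < 1`, which enlarges its zero-free region. The limit `s → 1` is controlled by a
Hurwitz-type growth bound (`norm_eval_le_of_no_roots`). -/

namespace UniversalSymbol

/-! ### Laguerre's and Grace's theorems for cones -/

/-- The determinant pairing on `ℂ²`. -/
def bracket (a b : Fin 2 → ℂ) : ℂ := a 0 * b 1 - a 1 * b 0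

theorem bracket_add_smul (a x y : Fin 2 → ℂ) (t : ℂ) :
    bracket a (x + t • y) = bracket a x + t * bracket a y := by
  simp [bracket]; ring

/-- The cone over an open circular region, in terms of an invertible matrix. -/
def circularCone (E : Matrix (Fin 2) (Fin 2) ℂ) : Set (Fin 2 → ℂ) :=
  {v | ‖E.mulVec v 1‖ < ‖E.mulVec v 0‖}

theorem ne_zero_of_mem_circularCone {E : Matrix (Fin 2) (Fin 2) ℂ} {v : Fin 2 → ℂ}
    (h : v ∈ circularCone E) : v ≠ 0 := by
  rintro rfl
  simp [circularCone] at h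

/-- Points of the line `x + t ζ` through two points of a circular cone that lie outside the cone
have their parameter in a fixed open half-plane. -/
theorem exists_halfPlane_of_notMem_circularCone {E : Matrix (Fin 2) (Fin 2) ℂ} {x ζ : Fin 2 → ℂ}
    (hx : x ∈ circularCone E) (hζ : ζ ∈ circularCone E) :
    ∃ c : ℂ, ∀ t : ℂ, x + t • ζ ∉ circularCone E → (c * t).re < 0 := by
  -- The cone is the positive set of the Hermitian form `H v = ‖(E v) 0‖² - ‖(E v) 1‖²`, and `H (x +
  -- t ζ) = H x + 2 Re (c t) + ‖t‖² H ζ` with `c` the polarization of `H` at `(ζ, x)`. Both outer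
  -- terms are nonnegative and the first is positive.
  refine ⟨E.mulVec ζ 0 * star (E.mulVec x 0) - E.mulVec ζ 1 * star (E.mulVec x 1), fun t ht => ?_⟩
  simp only [circularCone, Set.mem_ofPred_eq, not_lt, Matrix.mulVec_add, Matrix.mulVec_smul,
    Pi.add_apply, Pi.smul_apply, smul_eq_mul] at *
  generalize E.mulVec ζ 0 = a at *
  generalize E.mulVec ζ 1 = b at *
  generalize E.mulVec x 0 = p at *
  generalize E.mulVec x 1 = q at *
  have h1 := pow_lt_pow_left₀ hx (norm_nonneg _) two_ne_zero
  have h2 := pow_lt_pow_left₀ hζ (norm_nonneg _) two_ne_zero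
  have h3 := pow_le_pow_left₀ (norm_nonneg _) ht 2
  simp only [Complex.sq_norm, Complex.normSq_apply, Complex.add_re, Complex.add_im, Complex.mul_re,
    Complex.mul_im] at h1 h2 h3
  simp only [Complex.mul_re, Complex.sub_re, Complex.sub_im, Complex.mul_im, Complex.star_def,
    Complex.conj_re, Complex.conj_im]
  nlinarith [mul_nonneg (add_nonneg (mul_self_nonneg t.re) (mul_self_nonneg t.im))
    (sub_nonneg.2 h2.le)]

open Polynomial in
/-- **Laguerre's theorem** on polar derivatives, for sums of powers of linear forms. -/
theorem polar_ne_zero {I : Type*} [Fintype I] {E : Matrix (Fin 2) (Fin 2) ℂ} (n : ℕ)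
    (a : I → ℂ) (ξ : I → Fin 2 → ℂ)
    (h : ∀ x ∈ circularCone E, ∑ i, a i * bracket (ξ i) x ^ (n + 1) ≠ 0)
    {x ζ : Fin 2 → ℂ} (hx : x ∈ circularCone E) (hζ : ζ ∈ circularCone E) :
    ∑ i, a i * (bracket (ξ i) ζ * bracket (ξ i) x ^ n) ≠ 0 := by
  obtain ⟨c, hc⟩ := exists_halfPlane_of_notMem_circularCone hx hζ
  set φ : ℂ[X] := ∑ i, C (a i) * (C (bracket (ξ i) x) + X * C (bracket (ξ i) ζ)) ^ (n + 1) with hφ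
  -- `φ` is the form restricted to the line `x + t ζ`; its top coefficient is the value at `ζ`. The
  -- polar is `φ'(0) / (n + 1)`, and Gauss–Lucas confines the zeros of `φ'` to the half-plane, which
  -- omits `0`.
  have hcoeff : φ.coeff (n + 1) ≠ 0 := by
    rw [hφ, finsetSum_coeff]
    convert h ζ hζ using 2 with i
    rw [coeff_C_mul]
    have := coeff_pow_of_natDegree_le (p := C (bracket (ξ i) x) + X * C (bracket (ξ i) ζ))
      (n := 1) (m := n + 1) (by compute_degree)
    rw [mul_one] at this
    rw [this]
    simp
  have hder : derivative φ ≠ 0 := by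
    intro h0
    have := congrArg (fun q => q.coeff n) h0
    rw [coeff_derivative] at this
    simp only [coeff_zero, mul_eq_zero, hcoeff, false_or] at this
    exact Nat.cast_add_one_ne_zero n this
  have heval : eval 0 (derivative φ) =
      (n + 1 : ℂ) * ∑ i, a i * (bracket (ξ i) ζ * bracket (ξ i) x ^ n) := by
    simp [hφ, eval_finsetSum, derivative_pow, Finset.mul_sum]
    refine Finset.sum_congr rfl fun i _ => by ring
  intro hzero
  rw [hzero, mul_zero] at heval
  have hmem : (0 : ℂ) ∈ (derivative φ).rootSet ℂ := by
    rw [mem_rootSet]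
    exact ⟨hder, by simpa using heval⟩
  have hconv : Convex ℝ {t : ℂ | (c * t).re < 0} := by
    refine convex_halfSpace_lt (f := fun t : ℂ => (c * t).re) ⟨fun s t => ?_, fun r t => ?_⟩ 0
    · simp [mul_add]
    · simp; ring
  have hsub : φ.rootSet ℂ ⊆ {t : ℂ | (c * t).re < 0} := by
    intro t ht
    refine hc t fun hmem => h _ hmem ?_
    rw [mem_rootSet] at ht
    have := ht.2
    simpa [hφ, eval_finsetSum, bracket_add_smul, mul_comm t] using this
  have h0 := convexHull_min hsub hconv
    (rootSet_derivative_subset_convexHull_rootSet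
      (natDegree_pos_iff_degree_pos.1 (Nat.pos_of_ne_zero fun h => hder
        (derivative_of_natDegree_zero h))) hmem)
  simp at h0

/-- A bilinear form on `ℂ²` that does not vanish on `A × B`, where `A` and `B` overlap and cover
`ℂ² \ {0}`, is not symmetric. -/
theorem bilinear_not_symmetric {A B : Set (Fin 2 → ℂ)} (hcover : ∀ v, v ≠ 0 → v ∈ A ∨ v ∈ B)
    (hmeet : (A ∩ B).Nonempty) (M : (Fin 2 → ℂ) → (Fin 2 → ℂ) → ℂ) (r : Fin 2 → Fin 2 → ℂ)
    (hM : ∀ u v, M u v = ∑ i, ∑ j, r i j * (u i * v j))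
    (h : ∀ u ∈ A, ∀ v ∈ B, M u v ≠ 0) : r 0 1 - r 1 0 ≠ 0 := by
  intro hsymm
  have hs : r 0 1 = r 1 0 := sub_eq_zero.1 hsymm
  obtain ⟨u, huA, huB⟩ := hmeet
  -- `v` annihilates the linear form `M u ·`; by symmetry it also annihilates `M · u`.
  set v : Fin 2 → ℂ := ![-(r 0 1 * u 0 + r 1 1 * u 1), r 0 0 * u 0 + r 1 0 * u 1] with hv
  have h1 : M u v = 0 := by
    simp [hM, Fin.sum_univ_two, hv]; ring
  have h2 : M v u = 0 := by
    simp [hM, Fin.sum_univ_two, hv, hs]; ring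
  by_cases hv0 : v = 0
  · have e0 := congrFun hv0 0
    have e1 := congrFun hv0 1
    simp [hv] at e0 e1
    apply h u huA u huB
    simp only [hM, Fin.sum_univ_two]
    linear_combination u 0 * e1 - u 1 * e0
  · rcases hcover v hv0 with hA | hB
    · exact h v hA u huB h2
    · exact h u huA v hB h1

/-- Induction on the degree: polarizing once in each argument gives a bilinear form without zeros on
the product of the cones, and its antisymmetric part is, up to sign, the same expression of degree
`n` with one more factor `bracket (ξ i) (η i)`. -/
theorem contract_one {I : Type*} [Fintype I] {E F : Matrix (Fin 2) (Fin 2) ℂ}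
    (hcover : ∀ v, v ≠ 0 → v ∈ circularCone E ∨ v ∈ circularCone F)
    (hmeet : (circularCone E ∩ circularCone F).Nonempty) (η ξ : I → Fin 2 → ℂ) (n : ℕ) :
    ∀ a : I → ℂ, (∀ x ∈ circularCone E, ∀ z ∈ circularCone F,
      ∑ i, a i * (bracket (η i) x ^ n * bracket (ξ i) z ^ n) ≠ 0) →
    ∑ i, a i * bracket (ξ i) (η i) ^ n ≠ 0 := by
  induction n with
  | zero =>
    intro a h
    obtain ⟨u, hu, hu'⟩ := hmeet
    simpa using h u hu u hu'
  | succ n ih =>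
    intro a h
    have := ih (fun i => a i * bracket (ξ i) (η i)) fun x hx z hz => ?_
    · convert this using 2 with i
      ring
    -- Laguerre's theorem is applied in the `η` slot with `z'` fixed, then in the `ξ` slot.
    have h1 : ∀ u ∈ circularCone E, ∀ v ∈ circularCone F,
        ∑ i, a i * (bracket (η i) u * bracket (η i) x ^ n *
          (bracket (ξ i) v * bracket (ξ i) z ^ n)) ≠ 0 := by
      intro u hu v hv
      have := polar_ne_zero n
        (fun i => a i * (bracket (η i) u * bracket (η i) x ^ n)) ξ
        (fun z' hz' => ?_) hz hv
      · convert this using 2 with i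
        ring
      · have := polar_ne_zero n (fun i => a i * bracket (ξ i) z' ^ (n + 1)) η
          (fun x' hx' => ?_) hx hu
        · convert this using 2 with i
          ring
        · convert h x' hx' z' hz' using 2 with i
          ring
    have h2 := bilinear_not_symmetric hcover hmeet _
      (fun p q => ∑ i, a i * (bracket (η i) x ^ n * bracket (ξ i) z ^ n) *
        (bracket (η i) (Pi.single p 1) * bracket (ξ i) (Pi.single q 1))) ?_ h1
    · refine neg_ne_zero.1 ?_
      convert h2 using 1
      rw [← Finset.sum_neg_distrib, ← Finset.sum_sub_distrib]
      refine Finset.sum_congr rfl fun i _ => ?_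
      simp [bracket]
      ring
    · intro u v
      simp only [Fin.sum_univ_two, Finset.sum_mul, ← Finset.sum_add_distrib]
      refine Finset.sum_congr rfl fun i _ => ?_
      simp [bracket]
      ring

/-- **Grace's theorem** for products of circular regions, for sums of products of powers of linear
forms. -/
theorem contract_ne_zero {ι I : Type*} [Fintype ι] [Fintype I]
    {E F : ι → Matrix (Fin 2) (Fin 2) ℂ}
    (hcover : ∀ k v, v ≠ 0 → v ∈ circularCone (E k) ∨ v ∈ circularCone (F k))
    (hmeet : ∀ k, (circularCone (E k) ∩ circularCone (F k)).Nonempty)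
    (η ξ : I → ι → Fin 2 → ℂ) (n : ι → ℕ) (a : I → ℂ)
    (h : ∀ x z : ι → Fin 2 → ℂ, (∀ k, x k ∈ circularCone (E k)) →
      (∀ k, z k ∈ circularCone (F k)) →
      ∑ i, a i * ∏ k, (bracket (η i k) (x k) ^ n k * bracket (ξ i k) (z k) ^ n k) ≠ 0) :
    ∑ i, a i * ∏ k, bracket (ξ i k) (η i k) ^ n k ≠ 0 := by
  classical
  -- `S` is the set of coordinates already contracted; the remaining ones are frozen into the
  -- coefficients.
  have key : ∀ S : Finset ι, ∀ x z : ι → Fin 2 → ℂ, (∀ k, x k ∈ circularCone (E k)) →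
      (∀ k, z k ∈ circularCone (F k)) →
      ∑ i, a i * ∏ k, (if k ∈ S then bracket (ξ i k) (η i k) ^ n k else
        bracket (η i k) (x k) ^ n k * bracket (ξ i k) (z k) ^ n k) ≠ 0 := by
    intro S
    induction S using Finset.induction_on with
    | empty => simpa using h
    | insert k S hk ih =>
      intro x z hx hz
      have := contract_one (hcover k) (hmeet k) (fun i => η i k) (fun i => ξ i k) (n k)
        (fun i => a i * ∏ j ∈ Finset.univ.erase k,
          (if j ∈ S then bracket (ξ i j) (η i j) ^ n j else
            bracket (η i j) (x j) ^ n j * bracket (ξ i j) (z j) ^ n j)) fun x' hx' z' hz' => ?_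
      · convert this using 2 with i
        rw [← Finset.mul_prod_erase _ _ (Finset.mem_univ k)]
        rw [Finset.prod_congr rfl (g := fun j => (if j ∈ S then bracket (ξ i j) (η i j) ^ n j else
            bracket (η i j) (x j) ^ n j * bracket (ξ i j) (z j) ^ n j))]
        · simp; ring
        · intro j hj
          simp [Finset.ne_of_mem_erase hj]
      · convert ih (Function.update x k x') (Function.update z k z') ?_ ?_ using 2 with i
        · rw [← Finset.mul_prod_erase _ (fun k_1 => if k_1 ∈ S then _ else _) (Finset.mem_univ k)]
          rw [Finset.prod_congr rfl (s₁ := Finset.univ.erase k)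
            (g := fun j => (if j ∈ S then bracket (ξ i j) (η i j) ^ n j else
            bracket (η i j) (Function.update x k x' j) ^ n j *
              bracket (ξ i j) (Function.update z k z' j) ^ n j))]
          · simp [hk]; ring
          · intro j hj
            simp [Finset.ne_of_mem_erase hj]
        · intro j
          by_cases hj : j = k
          · subst hj; simpa
          · simpa [hj] using hx j
        · intro j
          by_cases hj : j = k
          · subst hj; simpa
          · simpa [hj] using hz j
  choose u hu hu' using hmeet
  simpa using key Finset.univ u u hu hu'

/-! ### A growth bound for zero-free polynomials -/

open Polynomial in
/-- A growth bound for polynomials without zeros in a disc around the origin. -/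
theorem norm_eval_le_of_no_roots (g : ℂ[X]) {N : ℕ} (hN : g.natDegree ≤ N) {δ : ℝ} (hδ : 0 < δ)
    (h : ∀ t : ℂ, ‖t‖ < δ → g.eval t ≠ 0) (t : ℂ) :
    ‖g.eval t‖ ≤ ‖g.eval 0‖ * (1 + ‖t‖ / δ) ^ N := by
  have hs := IsAlgClosed.splits g
  have hone : 1 ≤ 1 + ‖t‖ / δ := by
    have : 0 ≤ ‖t‖ / δ := by positivity
    linarith
  have hroot : ∀ r ∈ g.roots, δ ≤ ‖r‖ := fun r hr => by
    by_contra! hlt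
    exact h r hlt (isRoot_of_mem_roots hr)
  have hmul : ∀ m : Multiset ℂ, (∀ r ∈ m, δ ≤ ‖r‖) →
      ‖(m.map fun r => t - r).prod‖ ≤ ‖(m.map fun r => 0 - r).prod‖ *
        (1 + ‖t‖ / δ) ^ m.card := by
    intro m
    induction m using Multiset.induction_on with
    | empty => simp
    | cons r m ih =>
      intro hm
      have h1 := ih fun s hs => hm s (Multiset.mem_cons_of_mem hs)
      have hr := hm r (Multiset.mem_cons_self r m)
      -- Each linear factor grows by at most this ratio because `δ ≤ ‖r‖`.
      have h2 : ‖t - r‖ ≤ ‖0 - r‖ * (1 + ‖t‖ / δ) := by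
        have h3 : ‖t‖ ≤ ‖r‖ * (‖t‖ / δ) := by
          rw [← mul_div_assoc, le_div_iff₀ hδ, mul_comm]
          gcongr
        have := norm_sub_le t r
        rw [zero_sub, norm_neg]
        linarith
      simp only [Multiset.map_cons, Multiset.prod_cons, Multiset.card_cons, norm_mul, pow_succ]
      calc _ ≤ (‖0 - r‖ * (1 + ‖t‖ / δ)) * (‖(m.map fun r => 0 - r).prod‖ *
            (1 + ‖t‖ / δ) ^ m.card) := by gcongr
        _ = _ := by ring
  rw [hs.eval_eq_prod_roots, hs.eval_eq_prod_roots, norm_mul, norm_mul, mul_assoc]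
  gcongr
  refine (hmul g.roots hroot).trans ?_
  gcongr
  exact (card_roots' g).trans hN

/-! ### Multihomogeneous polynomials and powers of linear forms -/

section Algebra

variable {ι : Type*} [DecidableEq ι] {lam : ι → ℕ}

/-- Evaluation of a multihomogeneous polynomial at a tuple of vectors. -/
noncomputable def evalV (v : ι → Fin 2 → ℂ) : V lam →ₗ[ℂ] ℂ :=
  (MvPolynomial.aeval (fun a : ι × Fin 2 => v a.1 a.2)).toLinearMap ∘ₗ (V lam).subtype

theorem evalV_apply (v : ι → Fin 2 → ℂ) (p : V lam) :
    evalV v p = MvPolynomial.eval (fun a : ι × Fin 2 => v a.1 a.2)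
      (p : MvPolynomial (ι × Fin 2) ℂ) := by
  simp [evalV, MvPolynomial.aeval_eq_eval]

theorem eq_zero_of_evalV {p : V lam} (h : ∀ v, evalV v p = 0) : p = 0 := by
  apply Subtype.ext
  apply MvPolynomial.funext
  intro x
  have := h fun k j => x (k, j)
  rw [evalV_apply] at this
  simpa using this

theorem continuous_evalV (p : V lam) : Continuous fun v => evalV v p := by
  simp only [evalV_apply]
  exact (MvPolynomial.continuous_eval _).comp (by fun_prop)

variable [Fintype ι]

theorem evalV_basisMonomial (v : ι → Fin 2 → ℂ) (mu : ∀ k, Fin (lam k + 1)) :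
    evalV v (basisMonomial mu) = ∏ k, v k 0 ^ (mu k : ℕ) * v k 1 ^ (lam k - mu k : ℕ) := by
  simp [evalV_apply, basisMonomial]

/-- The product of powers of linear forms `∏ k, (η k 0 * y k - η k 1 * x k) ^ lam k`. -/
noncomputable def powProd (lam : ι → ℕ) (η : ι → Fin 2 → ℂ) : V lam :=
  ∑ mu : (∀ k, Fin (lam k + 1)),
    (((∏ k, (lam k).choose (mu k) : ℕ) : ℂ) *
      ∏ k, (η k 0 ^ (lam k - mu k : ℕ) * (-η k 1) ^ (mu k : ℕ))) • basisMonomial mu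

theorem evalV_powProd (η v : ι → Fin 2 → ℂ) :
    evalV v (powProd lam η) = ∏ k, bracket (η k) (v k) ^ lam k := by
  have h : ∀ k, bracket (η k) (v k) ^ lam k = ∑ j : Fin (lam k + 1),
      (((lam k).choose j : ℂ) * (η k 0 ^ (lam k - j : ℕ) * (-η k 1) ^ (j : ℕ))) *
        (v k 0 ^ (j : ℕ) * v k 1 ^ (lam k - j : ℕ)) := by
    intro k
    rw [Fin.sum_univ_eq_sum_range (fun j => (((lam k).choose j : ℂ) *
      (η k 0 ^ (lam k - j : ℕ) * (-η k 1) ^ (j : ℕ))) * (v k 0 ^ (j : ℕ) * v k 1 ^ (lam k - j : ℕ)))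
      (lam k + 1)]
    have : bracket (η k) (v k) = -η k 1 * v k 0 + η k 0 * v k 1 := by simp [bracket]; ring
    rw [this, add_pow]
    refine Finset.sum_congr rfl fun j _ => ?_
    rw [mul_pow, mul_pow]; ring
  simp_rw [h]
  rw [Finset.prod_univ_sum, powProd, map_sum, Fintype.piFinset_univ]
  refine Finset.sum_congr rfl fun mu _ => ?_
  rw [map_smul, evalV_basisMonomial]
  simp only [Finset.prod_mul_distrib, Nat.cast_prod, smul_eq_mul]

theorem continuous_powProd_apply {X : Type*} [TopologicalSpace X] (L : V lam →ₗ[ℂ] ℂ)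
    {η : X → ι → Fin 2 → ℂ} (hη : Continuous η) : Continuous fun s => L (powProd lam (η s)) := by
  simp only [powProd, map_sum, map_smul, smul_eq_mul]
  fun_prop

/-- Values of the symbol. -/
theorem evalV_symb {κ : Type*} [Fintype κ] [DecidableEq κ] {alpha : κ → ℕ}
    (T : V lam →ₗ[ℂ] V alpha) (v : ι ⊕ κ → Fin 2 → ℂ) :
    evalV v (symb T) = evalV (fun k => v (Sum.inr k)) (T (powProd lam fun k => v (Sum.inl k))) := by
  rw [evalV_apply]
  simp only [symb, powProd, map_sum, map_mul, map_smul, evalV_apply, inSecondBlock,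
    MvPolynomial.eval_rename, MvPolynomial.eval_C, map_prod, map_pow, map_neg,
    MvPolynomial.eval_X, smul_eq_mul]
  rfl

theorem span_basisMonomial :
    Submodule.span ℂ (Set.range (basisMonomial : (∀ k, Fin (lam k + 1)) → V lam)) = ⊤ := by
  rw [eq_top_iff]
  rintro p -
  have hsum : (p : MvPolynomial (ι × Fin 2) ℂ) = ∑ d ∈ (p : MvPolynomial (ι × Fin 2) ℂ).support,
      MvPolynomial.coeff d (p : MvPolynomial (ι × Fin 2) ℂ) •
        (MvPolynomial.monomial d (1 : ℂ)) := by
    conv_lhs => rw [MvPolynomial.as_sum (p : MvPolynomial (ι × Fin 2) ℂ)]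
    simp [MvPolynomial.smul_monomial]
  have hmem : (p : MvPolynomial (ι × Fin 2) ℂ) ∈ (Submodule.span ℂ
      (Set.range (basisMonomial : (∀ k, Fin (lam k + 1)) → V lam))).map (V lam).subtype := by
    rw [hsum]
    refine Submodule.sum_mem _ fun d hd => Submodule.smul_mem _ _ ?_
    have hw := p.2 (MvPolynomial.mem_support_iff.1 hd)
    have hk : ∀ k, d (k, 0) + d (k, 1) = lam k := by
      intro k
      have := congrFun hw k
      rw [Finsupp.weight_apply, Finsupp.sum_fintype _ _ (by simp)] at this
      simpa [Fintype.sum_prod_type, Pi.single_apply, Finset.sum_add_distrib] using this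
    refine ⟨basisMonomial fun k => ⟨d (k, 0), by have := hk k; omega⟩,
      Submodule.subset_span ⟨_, rfl⟩, ?_⟩
    rw [MvPolynomial.monomial_eq, Finsupp.prod_fintype _ _ (by simp), Fintype.prod_prod_type]
    simp only [basisMonomial, Submodule.subtype_apply, map_one, one_mul, Fin.prod_univ_two]
    refine Finset.prod_congr rfl fun k _ => ?_
    rw [← hk k]
    simp
  obtain ⟨q, hq, hqp⟩ := hmem
  rwa [← Subtype.ext hqp]

/-- A functional killing every product of powers gives a polynomial in `η` that vanishes
identically. Its coefficients are nonzero binomial products times the values of the functional on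
monomials. -/
theorem span_powProd : Submodule.span ℂ (Set.range (powProd lam)) = ⊤ := by
  by_contra hne
  obtain ⟨L, hL, hker⟩ := Submodule.exists_le_ker_of_lt_top _ (lt_top_iff_ne_top.2 hne)
  apply hL
  have h0 : ∀ η, L (powProd lam η) = 0 := fun η => hker (Submodule.subset_span ⟨η, rfl⟩)
  refine LinearMap.ext_on span_basisMonomial ?_
  rintro _ ⟨mu, rfl⟩
  set e : (∀ k, Fin (lam k + 1)) → (ι →₀ ℕ) := fun mu =>
    Finsupp.equivFunOnFinite.symm fun k => lam k - (mu k : ℕ) with he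
  have hinj : Function.Injective e := by
    intro mu nu h
    ext k
    have := DFunLike.congr_fun h k
    simp [he] at this
    have h1 := (mu k).isLt
    have h2 := (nu k).isLt
    omega
  have hpoly : ∑ mu : (∀ k, Fin (lam k + 1)), MvPolynomial.monomial (e mu)
      (((∏ k, (lam k).choose (mu k) : ℕ) : ℂ) * L (basisMonomial mu)) = 0 := by
    apply MvPolynomial.funext
    intro x
    -- The second coordinate `-1` turns the factors `(-η k 1) ^ mu k` into `1`.
    rw [map_zero, ← h0 fun k => ![x k, -1]]
    simp only [powProd, map_sum, map_smul, MvPolynomial.eval_monomial, smul_eq_mul]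
    refine Finset.sum_congr rfl fun mu _ => ?_
    rw [Finsupp.prod_fintype _ _ (by simp)]
    simp [he]
    ring
  have := congrArg (MvPolynomial.coeff (e mu)) hpoly
  simp only [MvPolynomial.coeff_sum, MvPolynomial.coeff_monomial, hinj.eq_iff, Finset.sum_ite_eq',
    Finset.mem_univ, if_true, MvPolynomial.coeff_zero, mul_eq_zero, Nat.cast_eq_zero,
    Finset.prod_eq_zero_iff] at this
  rcases this with ⟨k, -, hk⟩ | h
  · have := Nat.choose_pos (Nat.lt_succ_iff.1 (mu k).isLt)
    omega
  · simpa using h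

theorem exists_sum_powProd (p : V lam) : ∃ (n : ℕ) (d : Fin n → ℂ) (η : Fin n → ι → Fin 2 → ℂ),
    p = ∑ j, d j • powProd lam (η j) := by
  have h : p ∈ Submodule.span ℂ (Set.range (powProd lam)) := by
    rw [span_powProd]; trivial
  obtain ⟨n, d, g, hg⟩ := Submodule.mem_span_set'.1 h
  choose η hη using fun j : Fin n => (g j).2
  exact ⟨n, d, η, by simp [hη, hg]⟩

theorem evalV_smul (c : ι → ℂ) (v : ι → Fin 2 → ℂ) (p : V lam) :
    evalV (fun k => c k • v k) p = (∏ k, c k ^ lam k) * evalV v p := by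
  obtain ⟨n, d, η, rfl⟩ := exists_sum_powProd p
  have hb : ∀ (a b : Fin 2 → ℂ) (t : ℂ), bracket a (t • b) = t * bracket a b := by
    intro a b t
    simp [bracket]; ring
  simp only [map_sum, map_smul, evalV_powProd, hb, mul_pow, Finset.prod_mul_distrib, smul_eq_mul,
    Finset.mul_sum]
  exact Finset.sum_congr rfl fun j _ => by ring

/-- The transpose of a functional against products of powers of linear forms. -/
theorem exists_dual_polynomial (L : V lam →ₗ[ℂ] ℂ) :
    ∃ q : V lam, ∀ z, evalV z q = L (powProd lam z) := by
  refine ⟨∑ mu : (∀ k, Fin (lam k + 1)), (((∏ k, (lam k).choose (mu k) : ℕ) : ℂ) *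
    (∏ k, (-1) ^ (mu k : ℕ)) * L (basisMonomial mu)) • basisMonomial fun k => (mu k).rev, ?_⟩
  intro z
  simp only [powProd, map_sum, map_smul, evalV_basisMonomial, smul_eq_mul]
  refine Finset.sum_congr rfl fun mu _ => ?_
  have : ∏ k, (z k 0 ^ (lam k - mu k : ℕ) * (-z k 1) ^ (mu k : ℕ)) =
      (∏ k, (-1) ^ (mu k : ℕ)) *
        ∏ k, z k 0 ^ ((mu k).rev : ℕ) * z k 1 ^ (lam k - (mu k).rev : ℕ) := by
    rw [← Finset.prod_mul_distrib]
    refine Finset.prod_congr rfl fun k _ => ?_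
    have h := (mu k).isLt
    have h1 : ((mu k).rev : ℕ) = lam k - mu k := by rw [Fin.val_rev]; omega
    have h2 : lam k - (lam k - mu k : ℕ) = mu k := by omega
    rw [h1, h2, neg_pow]
    ring
  rw [this]
  ring

-- The degree bound depends on `lam` only, which makes the growth bound uniform along a family in `V
-- lam`.
open Polynomial in
theorem exists_line_polynomial (p : V lam) (u w : ι → Fin 2 → ℂ) :
    ∃ g : ℂ[X], g.natDegree ≤ ∑ k, lam k ∧ ∀ t : ℂ, g.eval t = evalV (u + t • w) p := by
  obtain ⟨n, d, η, rfl⟩ := exists_sum_powProd p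
  refine ⟨∑ j, C (d j) * ∏ k,
    (C (bracket (η j k) (u k)) + X * C (bracket (η j k) (w k))) ^ lam k, ?_, fun t => ?_⟩
  · refine natDegree_sum_le_of_forall_le _ _ fun j _ => (natDegree_C_mul_le _ _).trans
      ((natDegree_prod_le _ _).trans (Finset.sum_le_sum fun k _ => ?_))
    compute_degree
  · simp [eval_finsetSum, eval_prod, evalV_powProd, bracket_add_smul]
    refine Finset.sum_congr rfl fun j _ => ?_
    congr 1
    exact Finset.prod_congr rfl fun k _ => by ring

end Algebra

/-! ### Opposite cones and contractions -/

section Cones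

/-- The cone over the complement of the closure of a circular region. -/
def oppositeMatrix (E : Matrix (Fin 2) (Fin 2) ℂ) : Matrix (Fin 2) (Fin 2) ℂ :=
  E.submatrix Fin.rev id

variable {E : Matrix (Fin 2) (Fin 2) ℂ}

theorem mem_circularCone_oppositeMatrix {v : Fin 2 → ℂ} :
    v ∈ circularCone (oppositeMatrix E) ↔ ‖E.mulVec v 0‖ < ‖E.mulVec v 1‖ :=
  Iff.rfl

theorem mulVec_inv_mulVec (hE : IsUnit E.det) (w : Fin 2 → ℂ) :
    E.mulVec (E⁻¹.mulVec w) = w := by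
  rw [Matrix.mulVec_mulVec, Matrix.mul_nonsing_inv _ hE, Matrix.one_mulVec]

theorem inv_mulVec_mulVec (hE : IsUnit E.det) (w : Fin 2 → ℂ) :
    E⁻¹.mulVec (E.mulVec w) = w := by
  rw [Matrix.mulVec_mulVec, Matrix.nonsing_inv_mul _ hE, Matrix.one_mulVec]

theorem bracket_mulVec (g : Matrix (Fin 2) (Fin 2) ℂ) (a b : Fin 2 → ℂ) :
    bracket a (g.mulVec b) = bracket (g.adjugate.mulVec a) b := by
  simp [bracket, Matrix.mulVec, dotProduct, Fin.sum_univ_two, Matrix.adjugate_fin_two]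
  ring

theorem bracket_mulVec_mulVec (g : Matrix (Fin 2) (Fin 2) ℂ) (a b : Fin 2 → ℂ) :
    bracket (g.mulVec a) (g.mulVec b) = g.det * bracket a b := by
  simp [bracket, Matrix.mulVec, dotProduct, Fin.sum_univ_two, Matrix.det_fin_two]
  ring

/-- A vanishing determinant would make `E z` and `E v` proportional, but their coordinates compare
in opposite ways. The weak inequality for `v` lets the result reach the closed region. -/
theorem bracket_ne_zero {z v : Fin 2 → ℂ} (hz : z ∈ circularCone (oppositeMatrix E))
    (hv : ‖E.mulVec v 1‖ ≤ ‖E.mulVec v 0‖) (hv0 : E.mulVec v 0 ≠ 0) : bracket z v ≠ 0 := by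
  intro h
  have h1 := bracket_mulVec_mulVec E z v
  rw [h, mul_zero, bracket, sub_eq_zero] at h1
  have h2 := congrArg norm h1
  rw [norm_mul, norm_mul] at h2
  have h3 : ‖E.mulVec z 0‖ * ‖E.mulVec v 1‖ ≤ ‖E.mulVec z 0‖ * ‖E.mulVec v 0‖ := by gcongr
  have h4 : ‖E.mulVec z 0‖ * ‖E.mulVec v 0‖ < ‖E.mulVec z 1‖ * ‖E.mulVec v 0‖ :=
    mul_lt_mul_of_pos_right hz (norm_pos_iff.2 hv0)
  linarith

theorem circularCone_nonempty (hE : IsUnit E.det) : (circularCone E).Nonempty :=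
  ⟨E⁻¹.mulVec ![1, 0], by
    rw [circularCone, Set.mem_ofPred_eq, mulVec_inv_mulVec hE]
    simp⟩

/-- A matrix scaling the second coordinate with respect to `E`. -/
noncomputable def contraction (E : Matrix (Fin 2) (Fin 2) ℂ) (s : ℝ) :
    Matrix (Fin 2) (Fin 2) ℂ :=
  E⁻¹ * (Matrix.diagonal ![1, (s : ℂ)] * E)

theorem contraction_one (hE : IsUnit E.det) : contraction E 1 = 1 := by
  have : (Matrix.diagonal ![1, ((1 : ℝ) : ℂ)] : Matrix (Fin 2) (Fin 2) ℂ) = 1 := by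
    rw [← Matrix.diagonal_one]
    congr 1
    ext i
    fin_cases i <;> simp
  rw [contraction, this, one_mul, Matrix.nonsing_inv_mul _ hE]

theorem continuous_contraction : Continuous (contraction E) := by
  unfold contraction
  have : Continuous fun s : ℝ => (Matrix.diagonal ![1, (s : ℂ)] : Matrix (Fin 2) (Fin 2) ℂ) := by
    refine Continuous.matrix_diagonal (continuous_pi fun i => ?_)
    fin_cases i
    · exact continuous_const
    · exact Complex.continuous_ofReal
  fun_prop

theorem contraction_mulVec_mem_circularCone (hE : IsUnit E.det) {s : ℝ} {v : Fin 2 → ℂ}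
    (hv : v ∈ circularCone (Matrix.diagonal ![1, (s : ℂ)] * E)) :
    (contraction E s).mulVec v ∈ circularCone E := by
  simp only [contraction, ← Matrix.mulVec_mulVec, circularCone, Set.mem_ofPred_eq,
    mulVec_inv_mulVec hE] at *
  exact hv

/-- With `s < 1` the enlarged cone contains the boundary of the original one, the only part missed
by the two opposite open cones. -/
theorem circularCone_cover (hE : IsUnit E.det) {s : ℝ} (hs : s ∈ Set.Ioo (0 : ℝ) 1)
    (v : Fin 2 → ℂ) (hv : v ≠ 0) : v ∈ circularCone (Matrix.diagonal ![1, (s : ℂ)] * E) ∨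
      v ∈ circularCone (oppositeMatrix E) := by
  rw [mem_circularCone_oppositeMatrix, or_iff_not_imp_right, not_lt]
  intro h
  simp only [circularCone, Set.mem_ofPred_eq, ← Matrix.mulVec_mulVec, Matrix.mulVec_diagonal]
  simp only [Matrix.cons_val_one, Matrix.cons_val_zero, norm_mul,
    Complex.norm_real, one_mul, Real.norm_of_nonneg hs.1.le]
  have hpos : 0 < ‖E.mulVec v 0‖ := by
    rw [norm_pos_iff]
    intro h0
    rw [h0, norm_zero, norm_le_zero_iff] at h
    apply hv
    rw [← inv_mulVec_mulVec hE v]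
    have : E.mulVec v = 0 := by
      ext i
      fin_cases i <;> simp [h0, h]
    rw [this, Matrix.mulVec_zero]
  have := hs.2
  have := hs.1
  nlinarith

theorem circularCone_meet (hE : IsUnit E.det) {s : ℝ} (hs : s ∈ Set.Ioo (0 : ℝ) 1) :
    (circularCone (Matrix.diagonal ![1, (s : ℂ)] * E) ∩
      circularCone (oppositeMatrix E)).Nonempty := by
  obtain ⟨h0, h1⟩ := hs
  -- Any ratio strictly between `s` and `1` works; the midpoint is taken.
  refine ⟨E⁻¹.mulVec ![(((1 + s) / 2 : ℝ) : ℂ), 1], ?_, ?_⟩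
  · simp only [circularCone, Set.mem_ofPred_eq, ← Matrix.mulVec_mulVec, Matrix.mulVec_diagonal,
      mulVec_inv_mulVec hE, Matrix.cons_val_one, Matrix.cons_val_zero, norm_mul, norm_one,
      Complex.norm_real, one_mul, mul_one]
    rw [Real.norm_of_nonneg h0.le, Real.norm_of_nonneg (by linarith)]
    linarith
  · simp only [mem_circularCone_oppositeMatrix,
      mulVec_inv_mulVec hE, Matrix.cons_val_one, Matrix.cons_val_zero, norm_one,
      Complex.norm_real]
    rw [Real.norm_of_nonneg (by linarith)]
    linarith

theorem isOpen_circularCone : IsOpen (circularCone E) := by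
  unfold circularCone
  refine isOpen_lt ?_ ?_ <;>
  exact ((continuous_apply _).comp (Continuous.matrix_mulVec continuous_const continuous_id)).norm

end Cones

/-! ### The characterization for cones -/

section Main

variable {ι κ : Type*} [DecidableEq ι] [DecidableEq κ] {lam : ι → ℕ} {alpha : κ → ℕ}

/-- A linear map all of whose values are weakly stable has rank at most one. -/
theorem exists_rank_one {Ω : Set (κ → Fin 2 → ℂ)} (hΩ : Ω.Nonempty) (T : V lam →ₗ[ℂ] V alpha)
    (hT : ∀ q, (∀ u ∈ Ω, evalV u (T q) ≠ 0) ∨ T q = 0) :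
    ∃ (p₀ : V alpha) (ψ : V lam →ₗ[ℂ] ℂ),
      ((∀ u ∈ Ω, evalV u p₀ ≠ 0) ∨ p₀ = 0) ∧ ∀ p, T p = ψ p • p₀ := by
  by_cases h0 : T = 0
  · exact ⟨0, 0, Or.inr rfl, by simp [h0]⟩
  obtain ⟨q₀, hq₀⟩ : ∃ q, T q ≠ 0 := by
    by_contra! h
    exact h0 (LinearMap.ext h)
  obtain ⟨u, hu⟩ := hΩ
  have hu0 := ((hT q₀).resolve_right hq₀) u hu
  refine ⟨T q₀, (evalV u (T q₀))⁻¹ • (evalV u ∘ₗ T), hT q₀, fun p => ?_⟩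
  -- The combination is chosen so that its image vanishes at `u`; weak stability then makes the
  -- image zero.
  have := (hT (p - ((evalV u (T q₀))⁻¹ * evalV u (T p)) • q₀)).resolve_left fun h => h u hu (by
    simp only [map_sub, map_smul, smul_eq_mul]
    field_simp
    ring)
  rw [map_sub, map_smul, sub_eq_zero] at this
  simpa using this

variable [Fintype ι] [Fintype κ]

/-- If the symbol does not vanish for `z` in the opposite cones, then `T` maps `p` without zeros in
contracted cones to polynomials without zeros. -/
theorem evalV_map_contraction_ne_zero {E : ι → Matrix (Fin 2) (Fin 2) ℂ}
    (hE : ∀ k, IsUnit (E k).det) (L : V lam →ₗ[ℂ] ℂ)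
    (hL : ∀ z : ι → Fin 2 → ℂ, (∀ k, z k ∈ circularCone (oppositeMatrix (E k))) →
      L (powProd lam z) ≠ 0)
    {n : ℕ} (d : Fin n → ℂ) (η : Fin n → ι → Fin 2 → ℂ)
    (hp : ∀ x : ι → Fin 2 → ℂ, (∀ k, x k ∈ circularCone (E k)) →
      evalV x (∑ j, d j • powProd lam (η j)) ≠ 0) {s : ℝ} (hs : s ∈ Set.Ioo (0 : ℝ) 1) :
    L (∑ j, d j • powProd lam fun k => (contraction (E k) s).adjugate.mulVec (η j k)) ≠ 0 := by
  obtain ⟨q, hq⟩ := exists_dual_polynomial L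
  obtain ⟨n', c, ξ, rfl⟩ := exists_sum_powProd q
  -- Moving the contraction across the determinant turns it into its adjugate, so the polynomial
  -- paired with `q` is `p` composed with the contraction.
  have := contract_ne_zero (I := Fin n × Fin n')
    (E := fun k => Matrix.diagonal ![1, (s : ℂ)] * E k) (F := fun k => oppositeMatrix (E k))
    (fun k => circularCone_cover (hE k) hs) (fun k => circularCone_meet (hE k) hs)
    (fun i k => (contraction (E k) s).adjugate.mulVec (η i.1 k)) (fun i => ξ i.2) lam
    (fun i => d i.1 * c i.2) fun x z hx hz => ?_
  · convert this using 1
    simp only [map_sum, map_smul, smul_eq_mul, ← hq, evalV_powProd, Finset.mul_sum,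
      Fintype.sum_prod_type, mul_assoc]
  · have h1 := hp _ fun k => contraction_mulVec_mem_circularCone (hE k) (hx k)
    have h2 := hL z hz
    rw [← hq] at h2
    convert mul_ne_zero h1 h2 using 1
    simp only [map_sum, map_smul, smul_eq_mul, evalV_powProd, Finset.sum_mul_sum,
      Fintype.sum_prod_type, Finset.prod_mul_distrib, bracket_mulVec]
    exact Finset.sum_congr rfl fun i _ => Finset.sum_congr rfl fun j _ => by ring

-- Hurwitz's argument: the images of the contracted polynomials are zero-free, so near a zero `u₀`
-- of the limit their size at any `u` is bounded by a constant times their size at `u₀`, which tends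
-- to `0`.
open Filter Topology in
theorem map_weaklyStable_of_symb {E : ι → Matrix (Fin 2) (Fin 2) ℂ}
    {F : κ → Matrix (Fin 2) (Fin 2) ℂ} (hE : ∀ k, IsUnit (E k).det) (T : V lam →ₗ[ℂ] V alpha)
    (hT : ∀ z : ι → Fin 2 → ℂ, (∀ k, z k ∈ circularCone (oppositeMatrix (E k))) →
      ∀ u : κ → Fin 2 → ℂ, (∀ k, u k ∈ circularCone (F k)) → evalV u (T (powProd lam z)) ≠ 0)
    (p : V lam) (hp : ∀ x : ι → Fin 2 → ℂ, (∀ k, x k ∈ circularCone (E k)) → evalV x p ≠ 0) :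
    (∀ u : κ → Fin 2 → ℂ, (∀ k, u k ∈ circularCone (F k)) → evalV u (T p) ≠ 0) ∨ T p = 0 := by
  rw [or_iff_not_imp_left]
  push Not
  rintro ⟨u₀, hu₀, h0⟩
  refine eq_zero_of_evalV fun u => ?_
  obtain ⟨n, d, η, rfl⟩ := exists_sum_powProd p
  set P : ℝ → V lam := fun s =>
    ∑ j, d j • powProd lam fun k => (contraction (E k) s).adjugate.mulVec (η j k) with hP
  have hP1 : P 1 = ∑ j, d j • powProd lam (η j) := by
    simp only [hP, contraction_one (hE _), Matrix.adjugate_one, Matrix.one_mulVec]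
  have hcont : ∀ v : κ → Fin 2 → ℂ, Continuous fun s => evalV v (T (P s)) := by
    intro v
    simp only [hP, map_sum, map_smul, smul_eq_mul]
    refine continuous_finsetSum _ fun j _ => continuous_const.mul
      (continuous_powProd_apply (evalV v ∘ₗ T) (continuous_pi fun k => ?_))
    exact (continuous_contraction.matrix_adjugate).matrix_mulVec continuous_const
  have hne : ∀ s ∈ Set.Ioo (0 : ℝ) 1, ∀ v : κ → Fin 2 → ℂ, (∀ k, v k ∈ circularCone (F k)) →
      evalV v (T (P s)) ≠ 0 := fun s hs v hv =>
    evalV_map_contraction_ne_zero hE (evalV v ∘ₗ T) (fun z hz => hT z hz v hv) d η hp hs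
  have hopen : IsOpen {t : ℂ | ∀ k, (u₀ + t • (u - u₀)) k ∈ circularCone (F k)} := by
    simp only [Set.ofPred_forall]
    refine isOpen_iInter_of_finite fun k => isOpen_circularCone.preimage ?_
    fun_prop
  obtain ⟨δ, hδ, hball⟩ := Metric.isOpen_iff.1 hopen 0 (by simpa using hu₀)
  have hbound : ∀ s ∈ Set.Ioo (0 : ℝ) 1, ‖evalV u (T (P s))‖ ≤
      ‖evalV u₀ (T (P s))‖ * (1 + 1 / δ) ^ ∑ k, alpha k := by
    intro s hs
    -- On the line from `u₀` (at `t = 0`) to `u` (at `t = 1`), the radius `δ` of the zero-free disc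
    -- is independent of `s`.
    obtain ⟨g, hg, hgt⟩ := exists_line_polynomial (T (P s)) u₀ (u - u₀)
    have := norm_eval_le_of_no_roots g hg hδ (fun t ht => ?_) 1
    · simpa [hgt] using this
    · rw [hgt]
      exact hne s hs _ (hball (by simpa using ht))
  have hlim : ∀ v : κ → Fin 2 → ℂ, Tendsto (fun s => ‖evalV v (T (P s))‖) (𝓝[<] 1)
      (𝓝 ‖evalV v (T (P 1))‖) := fun v =>
    ((hcont v).norm.tendsto 1).mono_left nhdsWithin_le_nhds
  have := le_of_tendsto_of_tendsto (hlim u) ((hlim u₀).mul_const _)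
    (by filter_upwards [Ioo_mem_nhdsLT zero_lt_one] with s hs using hbound s hs)
  rw [hP1, h0, norm_zero, zero_mul] at this
  exact norm_le_zero_iff.1 this

/-- A product of powers of linear forms with zeros outside the closed cones stays without zeros in
the open cones under small perturbations. -/
theorem exists_perturbation {E : ι → Matrix (Fin 2) (Fin 2) ℂ} (hE : ∀ k, IsUnit (E k).det)
    {z : ι → Fin 2 → ℂ} (hz : ∀ k, z k ∈ circularCone (oppositeMatrix (E k))) (q : V lam) :
    ∃ ε : ℂ, ε ≠ 0 ∧ ∀ x : ι → Fin 2 → ℂ, (∀ k, x k ∈ circularCone (E k)) →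
      evalV x (powProd lam z + ε • q) ≠ 0 := by
  -- The closed regions, up to scaling of the vectors, are parametrized by the compact polydisc `K`.
  set v : (ι → ℂ) → ι → Fin 2 → ℂ := fun b k => (E k)⁻¹.mulVec ![1, b k] with hv
  have hvc : Continuous v := by
    refine continuous_pi fun k => Continuous.matrix_mulVec continuous_const
      (continuous_pi fun i => ?_)
    fin_cases i
    · exact continuous_const
    · exact continuous_apply k
  set K : Set (ι → ℂ) := Set.univ.pi fun _ => Metric.closedBall (0 : ℂ) 1 with hK
  have hKc : IsCompact K := isCompact_univ_pi fun _ => isCompact_closedBall _ _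
  have hne : ∀ b ∈ K, evalV (v b) (powProd lam z) ≠ 0 := by
    intro b hb
    rw [evalV_powProd]
    refine Finset.prod_ne_zero_iff.2 fun k _ => pow_ne_zero _ (bracket_ne_zero (hz k) ?_ ?_)
    · rw [hv, mulVec_inv_mulVec (hE k)]
      simpa using hb k (Set.mem_univ k)
    · rw [hv, mulVec_inv_mulVec (hE k)]
      simp
  obtain ⟨M, hM⟩ := hKc.exists_bound_of_continuousOn
    (f := fun b => evalV (v b) q / evalV (v b) (powProd lam z))
    (((continuous_evalV q).comp hvc).continuousOn.div
      ((continuous_evalV _).comp hvc).continuousOn hne)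
  have hpos : 0 < |M| + 1 := by positivity
  -- A zero of the perturbation would make the quotient bounded by `M` equal to `-(|M| + 1)`.
  refine ⟨((|M| + 1 : ℝ) : ℂ)⁻¹, inv_ne_zero (by exact_mod_cast hpos.ne'), fun x hx => ?_⟩
  set c : ι → ℂ := fun k => (E k).mulVec (x k) 0 with hc
  have hc0 : ∀ k, c k ≠ 0 := fun k => norm_pos_iff.1 ((norm_nonneg _).trans_lt (hx k))
  set b : ι → ℂ := fun k => (E k).mulVec (x k) 1 / c k with hb
  have hbK : b ∈ K := by
    intro k _
    rw [mem_closedBall_zero_iff, hb, norm_div, div_le_one (norm_pos_iff.2 (hc0 k))]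
    exact (hx k).le
  have hxv : x = fun k => c k • v b k := by
    funext k
    rw [hv, ← Matrix.mulVec_smul]
    conv_lhs => rw [← inv_mulVec_mulVec (hE k) (x k)]
    congr 1
    ext i
    fin_cases i
    · simp [hc]
    · simp [hb, mul_div_cancel₀ _ (hc0 k)]
  rw [hxv, evalV_smul]
  refine mul_ne_zero (Finset.prod_ne_zero_iff.2 fun k _ => pow_ne_zero _ (hc0 k)) ?_
  rw [map_add, map_smul, smul_eq_mul]
  intro h
  have h1 : evalV (v b) q / evalV (v b) (powProd lam z) = -((|M| + 1 : ℝ) : ℂ) := by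
    have hMne : ((|M| + 1 : ℝ) : ℂ) ≠ 0 := by exact_mod_cast hpos.ne'
    rw [div_eq_iff (hne b hbK)]
    field_simp at h
    linear_combination h
  have h2 := hM b hbK
  simp only [h1, norm_neg, Complex.norm_real, Real.norm_of_nonneg hpos.le] at h2
  linarith [le_abs_self M]

theorem preserves_iff_of_cones {E : ι → Matrix (Fin 2) (Fin 2) ℂ}
    {F : κ → Matrix (Fin 2) (Fin 2) ℂ} (hE : ∀ k, IsUnit (E k).det)
    (hF : ∀ k, IsUnit (F k).det) (T : V lam →ₗ[ℂ] V alpha) :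
    (∀ p : V lam, (∀ x ∈ Set.univ.pi fun k => circularCone (E k), evalV x p ≠ 0) →
      (∀ u ∈ Set.univ.pi fun k => circularCone (F k), evalV u (T p) ≠ 0) ∨ T p = 0) ↔
    (∀ z ∈ Set.univ.pi fun k => circularCone (oppositeMatrix (E k)),
      ∀ u ∈ Set.univ.pi fun k => circularCone (F k), evalV u (T (powProd lam z)) ≠ 0) ∨
    ∃ (p₀ : V alpha) (ψ : V lam →ₗ[ℂ] ℂ),
      ((∀ u ∈ Set.univ.pi fun k => circularCone (F k), evalV u p₀ ≠ 0) ∨ p₀ = 0) ∧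
        ∀ p, T p = ψ p • p₀ := by
  simp only [Set.mem_univ_pi]
  constructor
  · intro h
    by_cases h0 : ∃ z : ι → Fin 2 → ℂ, (∀ k, z k ∈ circularCone (oppositeMatrix (E k))) ∧
        T (powProd lam z) = 0
    · obtain ⟨z, hz, hTz⟩ := h0
      right
      choose u hu using fun k => circularCone_nonempty (hF k)
      refine exists_rank_one (Ω := {u | ∀ k, u k ∈ circularCone (F k)}) ⟨u, hu⟩ T fun q => ?_
      obtain ⟨ε, hε, hstab⟩ := exists_perturbation hE hz q
      have := h _ hstab
      rw [map_add, hTz, zero_add, map_smul] at this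
      simp only [map_smul, smul_eq_zero, hε, false_or, ne_eq] at this
      exact this
    · push Not at h0
      left
      intro z hz
      refine (h (powProd lam z) fun x hx => ?_).resolve_right (h0 z hz)
      rw [evalV_powProd]
      exact Finset.prod_ne_zero_iff.2 fun k _ => pow_ne_zero _
        (bracket_ne_zero (hz k) (hx k).le (norm_pos_iff.1 ((norm_nonneg _).trans_lt (hx k))))
  · rintro (h | ⟨p₀, ψ, hp₀, hT⟩) p hp
    · exact map_weaklyStable_of_symb hE T h p hp
    · rw [hT]
      by_cases hψ : ψ p = 0
      · simp [hψ]
      · simpa [hψ] using hp₀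

end Main

/-! ### From circular regions of the projective line to cones -/

section Regions

theorem mk_mem_ofComplex_image {v : Fin 2 → ℂ} (hv : v ≠ 0) (A : Set ℂ) :
    Projectivization.mk ℂ v hv ∈ ofComplex '' A ↔ v 1 ≠ 0 ∧ v 0 / v 1 ∈ A := by
  constructor
  · rintro ⟨z, hz, h⟩
    obtain ⟨a, ha⟩ := (Projectivization.mk_eq_mk_iff' ℂ _ _ _ _).1 h
    have h0 := congrFun ha 0
    have h1 := congrFun ha 1
    simp only [Pi.smul_apply, smul_eq_mul, Matrix.cons_val_zero, Matrix.cons_val_one] at h0 h1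
    have hv1 : v 1 ≠ 0 := fun h => by simp [h] at h1
    refine ⟨hv1, ?_⟩
    have hdiv : v 0 / v 1 = z := by
      rw [div_eq_iff hv1, ← h0]
      linear_combination -(v 0) * h1
    rwa [hdiv]
  · rintro ⟨h1, hA⟩
    refine ⟨_, hA, (Projectivization.mk_eq_mk_iff' ℂ _ _ _ _).2 ⟨(v 1)⁻¹, ?_⟩⟩
    ext i
    fin_cases i
    · simp [div_eq_inv_mul]
    · simp [h1]

/-- The matrix of the half-plane `0 < Re (a z + b)`. -/
def halfPlaneMatrix (a b : ℂ) : Matrix (Fin 2) (Fin 2) ℂ := !![a, b + 1; a, b - 1]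

theorem isUnit_det_halfPlaneMatrix {a : ℂ} (ha : a ≠ 0) (b : ℂ) :
    IsUnit (halfPlaneMatrix a b).det := by
  have : (halfPlaneMatrix a b).det = -2 * a := by
    simp [halfPlaneMatrix, Matrix.det_fin_two]; ring
  simp [this, ha]

theorem norm_sub_lt_norm_add_iff (p q : ℂ) : ‖p - q‖ < ‖p + q‖ ↔ 0 < (p * star q).re := by
  rw [← sq_lt_sq₀ (norm_nonneg _) (norm_nonneg _), Complex.sq_norm, Complex.sq_norm]
  simp only [Complex.normSq_apply, Complex.sub_re, Complex.sub_im, Complex.add_re, Complex.add_im,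
    Complex.mul_re, Complex.star_def, Complex.conj_re, Complex.conj_im]
  constructor <;> intro h <;> nlinarith

theorem re_mul_star_pos_iff {v : Fin 2 → ℂ} (a b : ℂ) :
    0 < ((a * v 0 + b * v 1) * star (v 1)).re ↔ v 1 ≠ 0 ∧ 0 < (a * (v 0 / v 1) + b).re := by
  by_cases h1 : v 1 = 0
  · simp [h1]
  have : (a * v 0 + b * v 1) * star (v 1) =
      (Complex.normSq (v 1) : ℂ) * (a * (v 0 / v 1) + b) := by
    rw [Complex.normSq_eq_conj_mul_self, Complex.star_def]
    field_simp
  rw [this, Complex.re_ofReal_mul]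
  simp [h1, mul_pos_iff_of_pos_left (Complex.normSq_pos.2 h1)]

theorem mem_circularCone_halfPlaneMatrix {a b : ℂ} {v : Fin 2 → ℂ} :
    v ∈ circularCone (halfPlaneMatrix a b) ↔ v 1 ≠ 0 ∧ 0 < (a * (v 0 / v 1) + b).re := by
  -- This is the Cayley transform: the real part of `w` is positive exactly when `w` is closer to
  -- `1` than to `-1`.
  rw [← re_mul_star_pos_iff, ← norm_sub_lt_norm_add_iff]
  simp only [circularCone, halfPlaneMatrix, Set.mem_ofPred_eq, Matrix.mulVec, dotProduct,
    Fin.sum_univ_two, Matrix.of_apply, Matrix.cons_val_zero, Matrix.cons_val_one]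
  ring_nf

/-- `E` describes the set `S ⊆ CP1`. -/
def IsConeOf (S : Set CP1) (E : Matrix (Fin 2) (Fin 2) ℂ) : Prop :=
  ∀ v (hv : v ≠ 0), Projectivization.mk ℂ v hv ∈ S ↔ v ∈ circularCone E

theorem IsOpenCircularRegion.exists_isConeOf {S : Set CP1} (hS : IsOpenCircularRegion S) :
    ∃ E : Matrix (Fin 2) (Fin 2) ℂ, IsUnit E.det ∧ IsConeOf S E := by
  rcases hS with ⟨c, r, hr, rfl⟩ | ⟨c, r, hr, rfl⟩ | ⟨a, b, ha, rfl⟩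
  · refine ⟨!![0, (r : ℂ); 1, -c], by simp [Matrix.det_fin_two, hr.ne'], fun v hv => ?_⟩
    rw [mk_mem_ofComplex_image]
    simp only [circularCone, Set.mem_ofPred_eq, Matrix.mulVec, dotProduct, Fin.sum_univ_two,
      Matrix.of_apply, Matrix.cons_val_zero, Matrix.cons_val_one, zero_mul, zero_add, one_mul,
      norm_mul, Complex.norm_real, Real.norm_of_nonneg hr.le, mem_ball_iff_norm]
    by_cases h1 : v 1 = 0
    · simp [h1]
    · rw [← div_lt_iff₀ (norm_pos_iff.2 h1), ← norm_div]
      simp only [ne_eq, h1, not_false_eq_true, true_and]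
      rw [add_div, mul_div_cancel_right₀ _ h1, ← sub_eq_add_neg]
  · refine ⟨!![1, -c; 0, (r : ℂ)], by simp [Matrix.det_fin_two, hr.ne'], fun v hv => ?_⟩
    rw [Set.mem_compl_iff, mk_mem_ofComplex_image]
    simp only [circularCone, Set.mem_ofPred_eq, Matrix.mulVec, dotProduct, Fin.sum_univ_two,
      Matrix.of_apply, Matrix.cons_val_zero, Matrix.cons_val_one, zero_mul, zero_add, one_mul,
      norm_mul, Complex.norm_real, Real.norm_of_nonneg hr.le, mem_closedBall_iff_norm]
    by_cases h1 : v 1 = 0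
    · have h0 : v 0 ≠ 0 := fun h0 => hv (by ext i; fin_cases i <;> simp [h0, h1])
      simp [h1, h0]
    · rw [← lt_div_iff₀ (norm_pos_iff.2 h1), ← norm_div]
      simp only [ne_eq, h1, not_false_eq_true, true_and, not_le]
      rw [add_div, mul_div_cancel_right₀ _ h1, ← sub_eq_add_neg]
  · refine ⟨halfPlaneMatrix a b, isUnit_det_halfPlaneMatrix ha b, fun v hv => ?_⟩
    rw [mk_mem_ofComplex_image, mem_circularCone_halfPlaneMatrix]
    rfl

/-- The opposite cone projects to an open set disjoint from `S`, and every nonzero vector with `‖(E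
v) 1‖ ≤ ‖(E v) 0‖` is a limit of vectors of the cone. -/
theorem IsConeOf.compl_closure {S : Set CP1} {E : Matrix (Fin 2) (Fin 2) ℂ} (hE : IsUnit E.det)
    (h : IsConeOf S E) : IsConeOf (closure S)ᶜ (oppositeMatrix E) := by
  have hcont : Continuous fun v : {v : Fin 2 → ℂ // v ≠ 0} =>
      Projectivization.mk ℂ v.1 v.2 := continuous_coinduced_rng
  intro v hv
  rw [Set.mem_compl_iff, mem_circularCone_oppositeMatrix, ← not_le, not_iff_not]
  constructor
  · intro hmem
    by_contra! hlt
    -- The cone is invariant under nonzero scalars, so the choice of representative is immaterial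
    -- and openness can be checked upstairs.
    set U : Set CP1 := {x | x.rep ∈ circularCone (oppositeMatrix E)} with hU
    have hUmk : ∀ w (hw : w ≠ 0), Projectivization.mk ℂ w hw ∈ U ↔
        w ∈ circularCone (oppositeMatrix E) := by
      intro w hw
      obtain ⟨a, ha⟩ := Projectivization.exists_smul_eq_mk_rep ℂ w hw
      simp only [hU, Set.mem_ofPred_eq, ← ha, mem_circularCone_oppositeMatrix, Units.smul_def,
        Matrix.mulVec_smul, Pi.smul_apply, norm_smul]
      exact mul_lt_mul_iff_right₀ (norm_pos_iff.2 a.ne_zero)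
    have hUo : IsOpen U := by
      rw [isOpen_coinduced]
      convert isOpen_circularCone.preimage continuous_subtype_val using 1
      ext w
      exact hUmk w.1 w.2
    obtain ⟨x, hxU, hxS⟩ := mem_closure_iff.1 hmem U hUo ((hUmk v hv).2 hlt)
    induction x using Projectivization.ind with
    | h w hw =>
      have h1 := (hUmk w hw).1 hxU
      have h2 := (h w hw).1 hxS
      exact lt_asymm (mem_circularCone_oppositeMatrix.1 h1) h2
  · intro hle
    have hv0 : E.mulVec v 0 ≠ 0 := by
      intro h0
      rw [h0, norm_zero, norm_le_zero_iff] at hle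
      apply hv
      rw [← inv_mulVec_mulVec hE v]
      have : E.mulVec v = 0 := by
        ext i
        fin_cases i <;> simp [h0, hle]
      rw [this, Matrix.mulVec_zero]
    have hmem : (⟨v, hv⟩ : {v : Fin 2 → ℂ // v ≠ 0}) ∈
        closure {w : {v : Fin 2 → ℂ // v ≠ 0} | w.1 ∈ circularCone E} := by
      -- Stretching the coordinate `(E v) 0` by `1 + t` moves `v` strictly inside the cone for `t >
      -- 0`.
      set f : ℝ → Fin 2 → ℂ := fun t =>
        v + (t : ℂ) • E⁻¹.mulVec ![E.mulVec v 0, 0] with hf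
      have hfE : ∀ t, E.mulVec (f t) = ![(1 + t) * E.mulVec v 0, E.mulVec v 1] := by
        intro t
        rw [hf, Matrix.mulVec_add, Matrix.mulVec_smul, mulVec_inv_mulVec hE]
        ext i
        fin_cases i
        · simp only [Fin.zero_eta, Pi.add_apply, Pi.smul_apply, smul_eq_mul, Matrix.cons_val_zero]
          ring
        · simp
      have hfcone : ∀ t : ℝ, 0 < t → f t ∈ circularCone E := by
        intro t ht
        rw [circularCone, Set.mem_ofPred_eq, hfE]
        have h1 : ‖(1 + t : ℂ)‖ = 1 + t := by
          rw [← Complex.ofReal_one, ← Complex.ofReal_add, Complex.norm_real,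
            Real.norm_of_nonneg (by linarith)]
        simp only [Matrix.cons_val_zero, Matrix.cons_val_one, norm_mul, h1]
        nlinarith [norm_pos_iff.2 hv0]
      have hfc : Continuous f := by
        fun_prop
      have hsub : Topology.IsInducing (Subtype.val : {v : Fin 2 → ℂ // v ≠ 0} → Fin 2 → ℂ) :=
        Topology.IsInducing.subtypeVal
      rw [hsub.closure_eq_preimage_closure_image, Set.mem_preimage]
      have hlim : Filter.Tendsto f (nhdsWithin 0 (Set.Ioi 0)) (nhds v) := by
        have := (hfc.tendsto 0).mono_left (nhdsWithin_le_nhds (s := Set.Ioi 0))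
        rwa [show f 0 = v by simp only [hf, Complex.ofReal_zero, zero_smul, add_zero]] at this
      refine mem_closure_of_tendsto hlim ?_
      filter_upwards [self_mem_nhdsWithin] with t ht
      exact ⟨⟨f t, ne_zero_of_mem_circularCone (hfcone t ht)⟩, hfcone t ht, rfl⟩
    exact map_mem_closure hcont hmem fun w hw => (h w.1 w.2).2 hw

theorem isStable_iff {ι : Type*} [DecidableEq ι] {lam : ι → ℕ} {C : ι → Set CP1}
    {E : ι → Matrix (Fin 2) (Fin 2) ℂ} (h : ∀ k, IsConeOf (C k) (E k)) (p : V lam) :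
    IsStable (Set.univ.pi C) p ↔
      ∀ v ∈ Set.univ.pi fun k => circularCone (E k), evalV v p ≠ 0 := by
  simp only [IsStable, evalV_apply, Set.mem_univ_pi]
  constructor
  · intro hp v hv
    exact hp v (fun k => ne_zero_of_mem_circularCone (hv k)) fun k => (h k _ _).2 (hv k)
  · intro hp v hv0 hv
    exact hp v fun k => (h k _ (hv0 k)).1 (hv k)

theorem IsConeOf.sumElim {ι κ : Type*} {C : ι → Set CP1} {D : κ → Set CP1}
    {E : ι → Matrix (Fin 2) (Fin 2) ℂ} {F : κ → Matrix (Fin 2) (Fin 2) ℂ}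
    (hC : ∀ k, IsConeOf (C k) (E k)) (hD : ∀ k, IsConeOf (D k) (F k)) (k : ι ⊕ κ) :
    IsConeOf (Sum.elim C D k) (Sum.elim E F k) := by
  rcases k with k | k
  · exact hC k
  · exact hD k

theorem isStable_symb_iff {ι κ : Type*} [Fintype ι] [DecidableEq ι] [Fintype κ] [DecidableEq κ]
    {lam : ι → ℕ} {alpha : κ → ℕ} {C : ι → Set CP1} {D : κ → Set CP1}
    {E : ι → Matrix (Fin 2) (Fin 2) ℂ} {F : κ → Matrix (Fin 2) (Fin 2) ℂ}
    (hC : ∀ k, IsConeOf (C k) (E k)) (hD : ∀ k, IsConeOf (D k) (F k))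
    (T : V lam →ₗ[ℂ] V alpha) :
    IsStable (Set.univ.pi (Sum.elim C D)) (symb T) ↔
      ∀ z ∈ Set.univ.pi fun k => circularCone (E k),
        ∀ u ∈ Set.univ.pi fun k => circularCone (F k), evalV u (T (powProd lam z)) ≠ 0 := by
  rw [isStable_iff (IsConeOf.sumElim hC hD)]
  simp only [Set.mem_univ_pi, evalV_symb]
  constructor
  · intro h z hz u hu
    refine h (Sum.elim z u) fun k => ?_
    rcases k with k | k
    · exact hz k
    · exact hu k
  · intro h v hv
    exact h _ (fun k => hv (Sum.inl k)) _ fun k => hv (Sum.inr k)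

/-- The symbol characterization of the preservers of weak stability for a product of open circular
regions. -/
theorem preservesWeakStability_iff {ι : Type*} [Fintype ι] [DecidableEq ι]
    {lam alpha : ι → ℕ} (T : V lam →ₗ[ℂ] V alpha)
    (C : ι → Set CP1) (hC : ∀ k, IsOpenCircularRegion (C k)) :
    PreservesWeakStability (Set.univ.pi C) T ↔
      (IsStable (Set.univ.pi (Sum.elim (fun k => (closure (C k))ᶜ) C)) (symb T) ∨
        ∃ (p₀ : V alpha) (ψ : V lam →ₗ[ℂ] ℂ),
          IsWeaklyStable (Set.univ.pi C) p₀ ∧ ∀ p, T p = ψ p • p₀) := by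
  choose E hE hEC using fun k => (hC k).exists_isConeOf
  have := preserves_iff_of_cones hE hE T
  rw [isStable_symb_iff (fun k => (hEC k).compl_closure (hE k)) hEC]
  simp only [PreservesWeakStability, IsWeaklyStable, isStable_iff hEC]
  exact this

theorem isOpenCircularRegion_upperHP : IsOpenCircularRegion upperHP := by
  refine Or.inr (Or.inr ⟨-Complex.I, 0, by simp, ?_⟩)
  simp [upperHP]

theorem compl_closure_upperHP : (closure upperHP)ᶜ = lowerHP := by
  have ha : -Complex.I ≠ 0 := by simp
  have h : IsConeOf upperHP (halfPlaneMatrix (-Complex.I) 0) := by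
    intro v hv
    rw [upperHP, mk_mem_ofComplex_image, mem_circularCone_halfPlaneMatrix]
    simp
  ext x
  induction x using Projectivization.ind with
  | h v hv =>
    rw [h.compl_closure (isUnit_det_halfPlaneMatrix ha 0) v hv, lowerHP, mk_mem_ofComplex_image]
    have h1 : v ∈ circularCone (oppositeMatrix (halfPlaneMatrix (-Complex.I) 0)) ↔
        v ∈ circularCone (halfPlaneMatrix Complex.I 0) := by
      rw [mem_circularCone_oppositeMatrix, circularCone, Set.mem_ofPred_eq]
      simp only [halfPlaneMatrix, Matrix.mulVec, dotProduct,
        Fin.sum_univ_two, Matrix.of_apply, Matrix.cons_val_zero, Matrix.cons_val_one]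
      -- Up to signs, exchanging the two rows amounts to replacing `-I` by `I`.
      rw [← norm_neg, ← norm_neg (-Complex.I * v 0 + (0 - 1) * v 1)]
      ring_nf
    rw [h1, mem_circularCone_halfPlaneMatrix]
    simp

end Regions

end UniversalSymbol

theorem mainTheorem6 {m : ℕ} (lam alpha : Fin m → ℕ)
    (T : UniversalSymbol.V lam →ₗ[ℂ] UniversalSymbol.V alpha) :
    (∀ C : Fin m → Set UniversalSymbol.CP1,
      (∀ k, UniversalSymbol.IsOpenCircularRegion (C k)) →
      (UniversalSymbol.PreservesWeakStability (Set.univ.pi C) T ↔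
        (UniversalSymbol.IsStable
            (Set.univ.pi (Sum.elim (fun k => (closure (C k))ᶜ) C)) (UniversalSymbol.symb T) ∨
          ∃ (p₀ : UniversalSymbol.V alpha) (ψ : UniversalSymbol.V lam →ₗ[ℂ] ℂ),
            UniversalSymbol.IsWeaklyStable (Set.univ.pi C) p₀ ∧ ∀ p, T p = ψ p • p₀))) ∧
    (UniversalSymbol.PreservesWeakStability
        (Set.univ.pi fun _ : Fin m => UniversalSymbol.upperHP) T ↔
      (UniversalSymbol.IsStable
          (Set.univ.pi (Sum.elim (fun _ : Fin m => UniversalSymbol.lowerHP)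
            (fun _ : Fin m => UniversalSymbol.upperHP))) (UniversalSymbol.symb T) ∨
        ∃ (p₀ : UniversalSymbol.V alpha) (ψ : UniversalSymbol.V lam →ₗ[ℂ] ℂ),
          UniversalSymbol.IsWeaklyStable
              (Set.univ.pi fun _ : Fin m => UniversalSymbol.upperHP) p₀ ∧
            ∀ p, T p = ψ p • p₀)) := by
  refine ⟨UniversalSymbol.preservesWeakStability_iff T, ?_⟩
  have h := UniversalSymbol.preservesWeakStability_iff T (fun _ => UniversalSymbol.upperHP)
    fun _ => UniversalSymbol.isOpenCircularRegion_upperHP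
  rwa [UniversalSymbol.compl_closure_upperHP] at h
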